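/- Let $R$ be an arbitrary (associative, unital) ring and let $\mathrm{sMod}_R$ be the category of simplicial left $R$-modules, with normalization functor $N:\mathrm{sMod}_R\to\mathrm{Ch}_{\ge 0}(R)$. In the Hurewicz model structure on $\mathrm{sMod}_R$, a map $f$ is by definition - a weak equivalence if $N(f)$ is a chain homotopy equivalence, - a fibration if $N(f)$ is a split epimorphism of $R$-modules in every degree $n>0$ (with no condition in degree $0$), - a cofibration if $N(f)$ is a split monomorphism of $R$-modules in every degree $n\ge 0$. For a simplicial $R$-module $A$ and a simplicial abelian group $K$, let $A\otimes K$ be the simplicial $R$-module $(A\otimes K)_n=A_n\otimes_{\mathbb Z}K_n$ and let $A^K$ be the simplicial $R$-module $(A^K)_n=\mathrm{Hom}_{\mathrm{sAb}}(K\otimes\mathbb Z\Delta^n,A)$, with $R$ acting through $A$ in both cases. Here $\mathbb Z\Delta^n$ is the degreewise free abelian group on the standard simplex $\Delta^n$. The vertices $e=0,1$ of $\Delta^1$ induce maps $\iota_e:A\to A\otimes\mathbb Z\Delta^1$ and $\mathrm{ev}_e:A^{\mathbb Z\Delta^1}\to A$. Two maps $f,g:A\to B$ are homotopic if there is $H:A\otimes\mathbb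 Z\Delta^1\to B$ with $H\iota_0=f$ and $H\iota_1=g$. A map $f:A\to B$ is a homotopy equivalence if there is $g:B\to A$ with $gf$ homotopic to $\mathrm{id}_A$ and $fg$ homotopic to $\mathrm{id}_B$. Then the three classes of maps of the Hurewicz model structure on $\mathrm{sMod}_R$ are characterized as follows. 1. A map $f$ is a weak equivalence if and only if it is a homotopy equivalence. 2. A map $p:E\to B$ is a fibration if and only if it has the homotopy lifting property: for every simplicial $R$-module $A$ and all maps $f:A\to E$, $g:A\otimes\mathbb Z\Delta^1\to B$ with $pf=g\iota_0$, there is $h:A\otimes\mathbb Z\Delta^1\to E$ with $h\iota_0=f$ and $ph=g$. 3. A map $i:A\to X$ is a cofibration if and only if it has the homotopy extension property: for every simplicial $R$-module $B$ and all maps $f:A\to B^{\mathbb Z\Delta^1}$, $g:X\to B$ with $\mathrm{ev}_0f=gi$, there is $h:X\to B^{\mathbb Z\Delta^1}$ with $hi=f$ and $\mathrm{ev}_0h=g$. -/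

import Mathlib

open CategoryTheory Opposite Simplicial
open scoped TensorProduct

universe v u

noncomputable section

namespace HurewiczSMod

/-! ### The Hurewicz classes of maps of non-negatively graded chain complexes -/

section ChainComplexes

variable (C : Type u) [Category.{v} C] [Abelian C]

/-- Hurewicz weak equivalences in `Ch_{≥0}(C)`: the chain homotopy equivalences. -/
def chWeakEquivalences : MorphismProperty (ChainComplex C ℕ) :=
  HomologicalComplex.homotopyEquivalences C (ComplexShape.down ℕ)

/-- Hurewicz fibrations in `Ch_{≥0}(C)`: the maps which are split epimorphisms in every positive
degree (with no condition in degree zero). -/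
def chFibrations : MorphismProperty (ChainComplex C ℕ) :=
  fun _ _ p => ∀ n : ℕ, 0 < n → IsSplitEpi (p.f n)

/-- Hurewicz cofibrations in `Ch_{≥0}(C)`: the maps which are split monomorphisms in every
degree. -/
def chCofibrations : MorphismProperty (ChainComplex C ℕ) :=
  fun _ _ i => ∀ n : ℕ, IsSplitMono (i.f n)

end ChainComplexes

/-! ### Simplicial modules and the Hurewicz classes on them -/

/-- Simplicial left `R`-modules. -/
abbrev SMod (R : Type u) [Ring R] := SimplicialObject (ModuleCat.{v} R)

/-- Simplicial abelian groups. -/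
abbrev SAb := SimplicialObject AddCommGrpCat.{v}

section Classes

variable (R : Type u) [Ring R]

/-- The normalization functor of the Dold-Kan correspondence (normalized Moore complex). -/
abbrev normalization : SMod.{v} R ⥤ ChainComplex (ModuleCat.{v} R) ℕ :=
  AlgebraicTopology.normalizedMooreComplex (ModuleCat.{v} R)

/-- The weak equivalences of the Hurewicz model structure on simplicial `R`-modules, transported
along the Dold-Kan correspondence. -/
def weakEquivalences : MorphismProperty (SMod.{v} R) :=
  (chWeakEquivalences (ModuleCat.{v} R)).inverseImage (normalization R)

/-- The fibrations of the Hurewicz model structure on simplicial `R`-modules. -/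
def fibrations : MorphismProperty (SMod.{v} R) :=
  (chFibrations (ModuleCat.{v} R)).inverseImage (normalization R)

/-- The cofibrations of the Hurewicz model structure on simplicial `R`-modules. -/
def cofibrations : MorphismProperty (SMod.{v} R) :=
  (chCofibrations (ModuleCat.{v} R)).inverseImage (normalization R)

end Classes

/-! ### The simplicial abelian groups `ℤT` and the tensor product of simplicial abelian groups -/

/-- The functor `T ↦ ℤT`, the degreewise free abelian group on a simplicial set. -/
def freeAb : SSet.{v} ⥤ SAb.{v} :=
  (SimplicialObject.whiskering _ _).obj AddCommGrpCat.free

/-- The cosimplicial object `n ↦ ℤΔ[n]` in simplicial abelian groups. -/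
def simplexAb : SimplexCategory ⥤ SAb.{v} :=
  SSet.stdSimplex.{v} ⋙ freeAb

/-- The tensor product over `ℤ` of two maps of abelian groups. -/
def grpTensorHom {M M' N N' : AddCommGrpCat.{v}} (f : M ⟶ M') (g : N ⟶ N') :
    AddCommGrpCat.of (M ⊗[ℤ] N) ⟶ AddCommGrpCat.of (M' ⊗[ℤ] N') :=
  AddCommGrpCat.ofHom
    (TensorProduct.map f.hom.toIntLinearMap g.hom.toIntLinearMap).toAddMonoidHom

lemma grpTensor_hom_ext {M N P : AddCommGrpCat.{v}} {f g : AddCommGrpCat.of (M ⊗[ℤ] N) ⟶ P}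
    (h : ∀ (a : M) (b : N), f.hom (a ⊗ₜ[ℤ] b) = g.hom (a ⊗ₜ[ℤ] b)) : f = g := by
  apply AddCommGrpCat.hom_ext
  apply AddMonoidHom.ext
  intro (x : M ⊗[ℤ] N)
  induction x using TensorProduct.induction_on with
  | zero => exact (map_zero f.hom).trans (map_zero g.hom).symm
  | tmul a b => exact h a b
  | add x y hx hy =>
    exact (map_add f.hom x y).trans ((congrArg₂ _ hx hy).trans (map_add g.hom x y).symm)

lemma grpTensorHom_id (M N : AddCommGrpCat.{v}) : grpTensorHom (𝟙 M) (𝟙 N) = 𝟙 _ :=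
  grpTensor_hom_ext fun _ _ => rfl

lemma grpTensorHom_comp {M M' M'' N N' N'' : AddCommGrpCat.{v}} (f : M ⟶ M') (f' : M' ⟶ M'')
    (g : N ⟶ N') (g' : N' ⟶ N'') :
    grpTensorHom (f ≫ f') (g ≫ g') = grpTensorHom f g ≫ grpTensorHom f' g' :=
  grpTensor_hom_ext fun _ _ => rfl

/-- The degreewise tensor product `(K ⊗ L)_n = K_n ⊗_ℤ L_n` of simplicial abelian groups. -/
@[simps]
def abTensor (K L : SAb.{v}) : SAb.{v} where
  obj n := AddCommGrpCat.of (K.obj n ⊗[ℤ] L.obj n)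
  map θ := grpTensorHom (K.map θ) (L.map θ)
  map_id n := by rw [K.map_id, L.map_id, grpTensorHom_id]
  map_comp θ φ := by rw [K.map_comp, L.map_comp, grpTensorHom_comp]

/-- The map `K ⊗ L ⟶ K ⊗ L'` induced by `g : L ⟶ L'`. -/
@[simps]
def abTensorMap (K : SAb.{v}) {L L' : SAb.{v}} (g : L ⟶ L') : abTensor K L ⟶ abTensor K L' where
  app n := grpTensorHom (𝟙 _) (g.app n)
  naturality n m θ := by
    change grpTensorHom (K.map θ) (L.map θ) ≫ grpTensorHom (𝟙 (K.obj m)) (g.app m) =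
      grpTensorHom (𝟙 (K.obj n)) (g.app n) ≫ grpTensorHom (K.map θ) (L'.map θ)
    rw [← grpTensorHom_comp, ← grpTensorHom_comp, g.naturality, Category.id_comp,
      Category.comp_id]

lemma abTensorMap_id (K L : SAb.{v}) : abTensorMap K (𝟙 L) = 𝟙 _ := by
  apply NatTrans.ext; funext n
  exact grpTensorHom_id _ _

lemma abTensorMap_comp (K : SAb.{v}) {L L' L'' : SAb.{v}} (g : L ⟶ L') (g' : L' ⟶ L'') :
    abTensorMap K (g ≫ g') = abTensorMap K g ≫ abTensorMap K g' := by
  apply NatTrans.ext; funext n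
  exact grpTensor_hom_ext fun _ _ => rfl

/-! ### Tensoring and cotensoring of simplicial modules over simplicial abelian groups -/

section Tensor

variable {R : Type u} [Ring R]

/-- The tensor product over `ℤ` of a map of `R`-modules and a map of abelian groups. -/
def modTensorHom {M M' : ModuleCat.{v} R} {N N' : AddCommGrpCat.{v}} (f : M ⟶ M') (g : N ⟶ N') :
    ModuleCat.of R (M ⊗[ℤ] N) ⟶ ModuleCat.of R (M' ⊗[ℤ] N') :=
  ModuleCat.ofHom (TensorProduct.AlgebraTensorModule.map f.hom g.hom.toIntLinearMap)

lemma modTensor_hom_ext {M P : ModuleCat.{v} R} {N : AddCommGrpCat.{v}}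
    {f g : ModuleCat.of R (M ⊗[ℤ] N) ⟶ P}
    (h : ∀ (a : M) (b : N), f.hom (a ⊗ₜ[ℤ] b) = g.hom (a ⊗ₜ[ℤ] b)) : f = g := by
  apply ModuleCat.hom_ext
  apply LinearMap.ext
  intro (x : M ⊗[ℤ] N)
  induction x using TensorProduct.induction_on with
  | zero => exact (map_zero f.hom).trans (map_zero g.hom).symm
  | tmul a b => exact h a b
  | add x y hx hy =>
    exact (map_add f.hom x y).trans ((congrArg₂ _ hx hy).trans (map_add g.hom x y).symm)

lemma modTensorHom_id (M : ModuleCat.{v} R) (N : AddCommGrpCat.{v}) :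
    modTensorHom (𝟙 M) (𝟙 N) = 𝟙 _ :=
  modTensor_hom_ext fun _ _ => rfl

lemma modTensorHom_comp {M M' M'' : ModuleCat.{v} R} {N N' N'' : AddCommGrpCat.{v}} (f : M ⟶ M')
    (f' : M' ⟶ M'') (g : N ⟶ N') (g' : N' ⟶ N'') :
    modTensorHom (f ≫ f') (g ≫ g') = modTensorHom f g ≫ modTensorHom f' g' :=
  modTensor_hom_ext fun _ _ => rfl

/-- The tensoring `(A ⊗ K)_n = A_n ⊗_ℤ K_n`, with `r • (a ⊗ k) = (r • a) ⊗ k`. -/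
@[simps]
def tensor (A : SMod.{v} R) (K : SAb.{v}) : SMod.{v} R where
  obj n := ModuleCat.of R (A.obj n ⊗[ℤ] K.obj n)
  map θ := modTensorHom (A.map θ) (K.map θ)
  map_id n := by rw [A.map_id, K.map_id, modTensorHom_id]
  map_comp θ φ := by rw [A.map_comp, K.map_comp, modTensorHom_comp]

variable (R) in
/-- The forgetful functor from simplicial `R`-modules to simplicial abelian groups. -/
abbrev forgetAb : SMod.{v} R ⥤ SAb.{v} :=
  (SimplicialObject.whiskering _ _).obj (forget₂ (ModuleCat.{v} R) AddCommGrpCat.{v})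

/-- Multiplication by `r : R`, as an endomorphism of the simplicial abelian group underlying a
simplicial `R`-module. -/
def scalar (A : SMod.{v} R) (r : R) : (forgetAb R).obj A ⟶ (forgetAb R).obj A where
  app n := AddCommGrpCat.ofHom (DistribSMul.toAddMonoidHom (A.obj n) r)
  naturality n m θ := by
    apply AddCommGrpCat.hom_ext
    apply AddMonoidHom.ext
    intro (x : A.obj n)
    exact (map_smul (A.map θ).hom r x).symm

/-- The pointwise `R`-module structure on the maps of simplicial abelian groups `K ⟶ A`, for a
simplicial `R`-module `A`: `(r • f) a = r • (f a)`. -/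
instance homModule (K : SAb.{v}) (A : SMod.{v} R) : Module R (K ⟶ (forgetAb R).obj A) where
  smul r f := f ≫ scalar A r
  one_smul f := by
    ext n x
    exact one_smul R (show A.obj n from (f.app n).hom x)
  mul_smul r s f := by
    ext n x
    exact mul_smul r s (show A.obj n from (f.app n).hom x)
  smul_zero r := by
    ext n x
    exact smul_zero (A := A.obj n) r
  smul_add r f g := by
    ext n x
    exact smul_add r (show A.obj n from (f.app n).hom x) (show A.obj n from (g.app n).hom x)
  add_smul r s f := by
    ext n x
    exact add_smul r s (show A.obj n from (f.app n).hom x)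
  zero_smul f := by
    ext n x
    exact zero_smul R (show A.obj n from (f.app n).hom x)

/-- The cotensoring `A ^ K`, the simplicial `R`-module with
`(A ^ K)_n = Hom_{sAb}(K ⊗ ℤΔ[n], A)`. -/
@[simps]
def cotensor (A : SMod.{v} R) (K : SAb.{v}) : SMod.{v} R where
  obj n := ModuleCat.of R
    (abTensor K (simplexAb.obj n.unop) ⟶ (forgetAb R).obj A)
  map θ := ModuleCat.ofHom
    { toFun := fun f => abTensorMap K (simplexAb.map θ.unop) ≫ f
      map_add' := fun f g => Preadditive.comp_add _ _ _ _ f g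
      map_smul' := fun r f => (Category.assoc _ f (scalar A r)).symm }
  map_id n := by
    apply ModuleCat.hom_ext
    apply LinearMap.ext
    intro f
    change abTensorMap K (simplexAb.map (𝟙 n.unop)) ≫ _ = _
    rw [simplexAb.map_id, abTensorMap_id]
    exact Category.id_comp _
  map_comp θ φ := by
    apply ModuleCat.hom_ext
    apply LinearMap.ext
    intro f
    change abTensorMap K (simplexAb.map (φ.unop ≫ θ.unop)) ≫ _ =
      abTensorMap K (simplexAb.map φ.unop) ≫
        abTensorMap K (simplexAb.map θ.unop) ≫ _
    rw [simplexAb.map_comp, abTensorMap_comp]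
    exact Category.assoc _ _ _

/-- The simplicial abelian group `ℤΔ¹`. -/
abbrev interval : SAb.{v} := simplexAb.obj ⦋1⦌

/-- The basis element of `(ℤΔ¹)_n` given by the degenerate simplex at the vertex `e` of `Δ¹`. -/
def vertex (e : Fin 2) (n : SimplexCategoryᵒᵖ) : interval.{v}.obj n :=
  FreeAbelianGroup.of (SSet.stdSimplex.const 1 e n)

/-- The basis element of `(ℤΔ[n])_n` given by the nondegenerate top simplex. -/
def topSimplex (n : SimplexCategoryᵒᵖ) : (simplexAb.{v}.obj n.unop).obj n :=
  FreeAbelianGroup.of (SSet.stdSimplex.objEquiv.symm (𝟙 n.unop))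

lemma map_vertex (e : Fin 2) {n m : SimplexCategoryᵒᵖ} (θ : n ⟶ m) :
    (interval.{v}.map θ).hom (vertex e n) = vertex e m :=
  rfl

lemma map_topSimplex {n m : SimplexCategoryᵒᵖ} (θ : n ⟶ m) :
    ((simplexAb.{v}.obj n.unop).map θ).hom (topSimplex n) =
      ((simplexAb.{v}.map θ.unop).app m).hom (topSimplex m) :=
  rfl

/-- The inclusion `ι_e : A ⟶ A ⊗ ℤΔ¹` of the end `e` of the cylinder, `a ↦ a ⊗ e`. -/
def cylinderEnd (e : Fin 2) (A : SMod.{v} R) : A ⟶ tensor A interval where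
  app n := ModuleCat.ofHom (X := A.obj n) (Y := (tensor A interval).obj n)
    { toFun := fun a => (a ⊗ₜ[ℤ] vertex e n : A.obj n ⊗[ℤ] interval.obj n)
      map_add' := fun a b => TensorProduct.add_tmul a b _
      map_smul' := fun r a => (TensorProduct.smul_tmul' r a (vertex e n)).symm }
  naturality n m θ := by
    apply ModuleCat.hom_ext
    apply LinearMap.ext
    intro (a : A.obj n)
    change ((A.map θ).hom a ⊗ₜ[ℤ] vertex e m : A.obj m ⊗[ℤ] interval.obj m) =
      (A.map θ).hom a ⊗ₜ[ℤ] (interval.map θ).hom (vertex e n)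
    rw [map_vertex]

/-- The element `e ⊗ id_[n]` of `(ℤΔ¹ ⊗ ℤΔ[n])_n`. -/
def vertexTop (e : Fin 2) (n : SimplexCategoryᵒᵖ) :
    (abTensor interval.{v} (simplexAb.obj n.unop)).obj n :=
  (vertex e n ⊗ₜ[ℤ] topSimplex n : interval.{v}.obj n ⊗[ℤ] (simplexAb.{v}.obj n.unop).obj n)

lemma map_vertexTop (e : Fin 2) {n m : SimplexCategoryᵒᵖ} (θ : n ⟶ m) :
    ((abTensor interval.{v} (simplexAb.obj n.unop)).map θ).hom (vertexTop e n) =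
      ((abTensorMap interval.{v} (simplexAb.map θ.unop)).app m).hom (vertexTop e m) := by
  change ((interval.map θ).hom (vertex e n) ⊗ₜ[ℤ]
      ((simplexAb.{v}.obj n.unop).map θ).hom (topSimplex n) :
        interval.{v}.obj m ⊗[ℤ] (simplexAb.{v}.obj n.unop).obj m) =
    vertex e m ⊗ₜ[ℤ] ((simplexAb.{v}.map θ.unop).app m).hom (topSimplex m)
  rw [map_topSimplex, map_vertex]

/-- The evaluation `ev_e : A ^ ℤΔ¹ ⟶ A` of paths at the end `e`: it is the map induced by the
vertex `e` of `Δ¹`, and sends `f : ℤΔ¹ ⊗ ℤΔ[n] ⟶ A` to the `n`-simplex `f (e ⊗ id_[n])`. -/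
def pathEval (e : Fin 2) (A : SMod.{v} R) : cotensor A interval ⟶ A where
  app n := ModuleCat.ofHom (X := (cotensor A interval).obj n) (Y := A.obj n)
    { toFun := fun (f : abTensor interval (simplexAb.obj n.unop) ⟶ (forgetAb R).obj A) =>
        (f.app n).hom (vertexTop e n)
      map_add' := fun f g => rfl
      map_smul' := fun r f => rfl }
  naturality n m θ := by
    apply ModuleCat.hom_ext
    apply LinearMap.ext
    intro (f : abTensor interval (simplexAb.obj n.unop) ⟶ (forgetAb R).obj A)
    change (f.app m).hom (((abTensorMap interval (simplexAb.map θ.unop)).app m).hom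
      (vertexTop e m)) = (((forgetAb R).obj A).map θ).hom ((f.app n).hom (vertexTop e n))
    rw [← map_vertexTop]
    exact ConcreteCategory.congr_hom (f.naturality θ) (vertexTop e n)

/-! ### Homotopies, the homotopy lifting and the homotopy extension property -/

/-- Simplicial homotopy of maps of simplicial `R`-modules, through the cylinder `A ⊗ ℤΔ¹`. -/
def Homotopic {A B : SMod.{v} R} (f g : A ⟶ B) : Prop :=
  ∃ H : tensor A interval ⟶ B, cylinderEnd 0 A ≫ H = f ∧ cylinderEnd 1 A ≫ H = g

/-- `f` is a (simplicial) homotopy equivalence. -/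
def IsHomotopyEquivalence {A B : SMod.{v} R} (f : A ⟶ B) : Prop :=
  ∃ g : B ⟶ A, Homotopic (f ≫ g) (𝟙 A) ∧ Homotopic (g ≫ f) (𝟙 B)

/-- The homotopy lifting property: every square from `ι₀ : A ⟶ A ⊗ ℤΔ¹` to `p` has a diagonal
filler. -/
def HasHLP {E B : SMod.{v} R} (p : E ⟶ B) : Prop :=
  ∀ (A : SMod.{v} R) (f : A ⟶ E) (g : tensor A interval ⟶ B),
    f ≫ p = cylinderEnd 0 A ≫ g →
      ∃ h : tensor A interval ⟶ E, cylinderEnd 0 A ≫ h = f ∧ h ≫ p = g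

/-- The homotopy extension property: every square from `i` to `ev₀ : B ^ ℤΔ¹ ⟶ B` has a diagonal
filler. -/
def HasHEP {A X : SMod.{v} R} (i : A ⟶ X) : Prop :=
  ∀ (B : SMod.{v} R) (f : A ⟶ cotensor B interval) (g : X ⟶ B),
    f ≫ pathEval 0 B = i ≫ g →
      ∃ h : X ⟶ cotensor B interval, i ≫ h = f ∧ h ≫ pathEval 0 B = g

end Tensor

end HurewiczSMod

end

/-! The normalization `N` is an equivalence (Dold-Kan), so everything reduces to chain complexes
once simplicial homotopies are known to correspond to chain homotopies (`homotopic_iff`). From the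
simplicial side, the prism decomposition gives a chain homotopy between the two ends of the
cylinder. From the chain side, `N(A ⊗ ℤΔ¹)` need not be the algebraic cylinder; it suffices that its
two ends share the retraction `σ` and can be told apart degreewise by an `R`-linear map
(`exists_hom_of_homotopy`, `exists_normalized_retraction`). The characterization of weak
equivalences follows at once.

Fibrations have the lifting property because `ι₀` is the inclusion of a deformation retract, and
cofibrations have the extension property because `ev₀` is the projection onto one. Both deformations
come from the minimum operation on `Δ[1]`. The fillers are explicit: the degreewise sections or
retractions are not chain maps, but they are only used inside null-homotopic maps
(`exists_lift_of_deformationRetract`, `exists_lift_of_isSplitMono`).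

Conversely, the properties are tested on disks. A disk is contractible, and the component of a
contraction from its lower to its upper degree is invertible, being minus the inverse of the
differential (`isIso_of_homotopy_disk`). Lifting or extending the contraction factors an isomorphism
through `N(p)` in a positive degree, or through `N(i)` in any degree, which gives the splitting. -/

noncomputable section

namespace HurewiczSMod

/-! ### Lifting, extension and realization of homotopies in complexes -/

section Complexes

variable {V : Type u} [Category.{v} V] [Preadditive V] {ι : Type*} {c : ComplexShape ι}

open Homotopy in
lemma eq_add_nullHomotopicMap {K L : HomologicalComplex V c} {f g : K ⟶ L} (h : Homotopy f g) :
    f = nullHomotopicMap h.hom + g := by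
  ext n
  exact h.comm n

/-- The other components meet a zero differential or do not occur. For chain complexes over `ℕ` the
relevant target degrees are `j = i + 1`, which is why fibrations need no condition in degree zero.
-/
lemma nullHomotopicMap_congr {K L : HomologicalComplex V c} {h h' : ∀ i j, K.X i ⟶ L.X j}
    (hh : ∀ i j, c.Rel j i → h i j = h' i j) :
    Homotopy.nullHomotopicMap h = Homotopy.nullHomotopicMap h' := by
  ext n
  change dNext n h + prevD n h = dNext n h' + prevD n h'
  congr 1
  · by_cases hn : c.Rel n (c.next n)
    · rw [dNext_eq _ hn, dNext_eq _ hn, hh _ _ hn]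
    · simp [dNext, K.shape _ _ hn]
  · by_cases hn : c.Rel (c.prev n) n
    · rw [prevD_eq _ hn, prevD_eq _ hn, hh _ _ hn]
    · simp [prevD, L.shape _ _ hn]

lemma nullHomotopicMap_eq_zero {K L : HomologicalComplex V c} {h : ∀ i j, K.X i ⟶ L.X j}
    (hh : ∀ i j, h i j = 0) : Homotopy.nullHomotopicMap h = 0 := by
  ext n
  change dNext n h + prevD n h = 0
  simp [dNext, prevD, hh]

/-- The inclusion of a strong deformation retract has the left lifting property against the maps
with sections in all degrees that are the target of a homotopy. -/
lemma exists_lift_of_deformationRetract {U W E B : HomologicalComplex V c} {i : U ⟶ W} {σ : W ⟶ U}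
    (hσ : i ≫ σ = 𝟙 U) (H : Homotopy (σ ≫ i) (𝟙 W)) {p : E ⟶ B}
    (hp : ∀ a b, c.Rel b a → IsSplitEpi (p.f b)) (f : U ⟶ E) (g : W ⟶ B) (h : f ≫ p = i ≫ g) :
    ∃ l : W ⟶ E, i ≫ l = f ∧ l ≫ p = g := by
  classical
  have hs : ∀ b, ∃ s : B.X b ⟶ E.X b, ∀ a, c.Rel b a → s ≫ p.f b = 𝟙 _ := by
    intro b
    by_cases hb : ∃ a, c.Rel b a
    · obtain ⟨a, ha⟩ := hb
      have := hp a b ha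
      exact ⟨section_ (p.f b), fun _ _ => IsSplitEpi.id _⟩
    · exact ⟨0, fun a ha => (hb ⟨a, ha⟩).elim⟩
  choose s hs using hs
  set e : W ⟶ W := σ ≫ i - 𝟙 W with he
  have hH : Homotopy.nullHomotopicMap H.hom = e := by
    rw [he, eq_sub_iff_add_eq, ← eq_add_nullHomotopicMap]
  have hie : i ≫ e = 0 := by simp [he, reassoc_of% hσ]
  have hee : e ≫ e = -e := by
    rw [he]
    simp [reassoc_of% hσ]
  -- `σ ≫ f` is a first approximation, with the right restriction along `i`. Precomposing the
  -- homotopy with `e` makes the correction vanish on `U`, since `i ≫ e = 0`. After composing with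
  -- `p` the sections cancel, and the correction becomes `e ≫ e ≫ g = -(e ≫ g) = g - σ ≫ i ≫ g`.
  refine ⟨σ ≫ f + Homotopy.nullHomotopicMap (fun a b => e.f a ≫ H.hom a b ≫ g.f b ≫ s b), ?_, ?_⟩
  · rw [Preadditive.comp_add, reassoc_of% hσ, Homotopy.comp_nullHomotopicMap,
      nullHomotopicMap_eq_zero, add_zero]
    intro a b
    rw [← HomologicalComplex.comp_f_assoc, hie]
    simp
  · rw [Preadditive.add_comp, Homotopy.nullHomotopicMap_comp,
      nullHomotopicMap_congr (h' := fun a b => e.f a ≫ H.hom a b ≫ g.f b)]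
    · rw [← Homotopy.comp_nullHomotopicMap e (fun a b => H.hom a b ≫ g.f b),
        ← Homotopy.nullHomotopicMap_comp, hH, reassoc_of% hee, Category.assoc, h, he]
      simp
    · intro a b hab
      simp [hs b a hab]

/-- The projection onto a strong deformation retract has the right lifting property against the
degreewise split monomorphisms. -/
lemma exists_lift_of_isSplitMono {A X P B : HomologicalComplex V c} {ev : P ⟶ B} {s : B ⟶ P}
    (hs : s ≫ ev = 𝟙 B) (H : Homotopy (ev ≫ s) (𝟙 P)) {i : A ⟶ X}
    (hi : ∀ n, IsSplitMono (i.f n)) (f : A ⟶ P) (g : X ⟶ B) (h : f ≫ ev = i ≫ g) :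
    ∃ l : X ⟶ P, i ≫ l = f ∧ l ≫ ev = g := by
  set e : P ⟶ P := ev ≫ s - 𝟙 P with he
  have hH : Homotopy.nullHomotopicMap H.hom = e := by
    rw [he, eq_sub_iff_add_eq, ← eq_add_nullHomotopicMap]
  have hie : e ≫ ev = 0 := by simp [he, hs]
  have hee : e ≫ e = -e := by
    rw [he]
    simp [reassoc_of% hs]
  -- Dual to the previous filler: `e ≫ ev = 0` makes the correction invisible to `ev`. Along `i` the
  -- retractions cancel, and it becomes `f ≫ e ≫ e = f - f ≫ ev ≫ s`.
  refine ⟨g ≫ s + Homotopy.nullHomotopicMap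
    (fun a b => retraction (i.f a) ≫ f.f a ≫ H.hom a b ≫ e.f b), ?_, ?_⟩
  · rw [Preadditive.comp_add, Homotopy.comp_nullHomotopicMap,
      nullHomotopicMap_congr (h' := fun a b => f.f a ≫ H.hom a b ≫ e.f b)]
    · rw [← Homotopy.comp_nullHomotopicMap f (fun a b => H.hom a b ≫ e.f b),
        ← Homotopy.nullHomotopicMap_comp, hH, hee, ← reassoc_of% h, he]
      simp
    · intro a b _
      simp
  · rw [Preadditive.add_comp, Homotopy.nullHomotopicMap_comp, nullHomotopicMap_eq_zero, add_zero,
      Category.assoc, hs, Category.comp_id]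
    intro a b
    simp only [Category.assoc]
    rw [← HomologicalComplex.comp_f, hie]
    simp

/-- Homotopies are represented by maps out of any complex that looks like a cylinder. -/
lemma exists_hom_of_homotopy {U C W : HomologicalComplex V c} {ι₀ ι₁ : U ⟶ C} {σ : C ⟶ U}
    (h₀ : ι₀ ≫ σ = 𝟙 U) (h₁ : ι₁ ≫ σ = 𝟙 U) (r : ∀ n, C.X n ⟶ U.X n)
    (hr₀ : ∀ n, ι₀.f n ≫ r n = 0) (hr₁ : ∀ n, ι₁.f n ≫ r n = 𝟙 _) {f g : U ⟶ W}
    (H : Homotopy f g) : ∃ G : C ⟶ W, ι₀ ≫ G = f ∧ ι₁ ≫ G = g := by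
  -- Start with the constant homotopy at `f`. Since `r` kills the end `ι₀` and is the identity on
  -- `ι₁`, the correction subtracts `f - g` at `ι₁` only.
  refine ⟨σ ≫ f - Homotopy.nullHomotopicMap (fun a b => r a ≫ H.hom a b), ?_, ?_⟩
  · rw [Preadditive.comp_sub, reassoc_of% h₀, Homotopy.comp_nullHomotopicMap,
      nullHomotopicMap_eq_zero, sub_zero]
    intro a b
    rw [reassoc_of% hr₀, Limits.zero_comp]
  · rw [Preadditive.comp_sub, reassoc_of% h₁, Homotopy.comp_nullHomotopicMap,
      nullHomotopicMap_congr (h' := H.hom), sub_eq_iff_eq_add', ← eq_add_nullHomotopicMap]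
    intro a b _
    rw [reassoc_of% hr₁]

end Complexes

/-! ### Disk complexes -/

section Disk

variable {V : Type u} [Category.{v} V] [Preadditive V] [Limits.HasZeroObject V]

lemma down_rel_succ (m : ℕ) : (ComplexShape.down ℕ).Rel (m + 1) m := rfl

/-- The complex with `M` in degrees `m + 1` and `m`, and the identity as differential. -/
abbrev disk (M : V) (m : ℕ) : ChainComplex V ℕ :=
  HomologicalComplex.double (𝟙 M) (down_rel_succ m)

/-- The object of a disk in its upper degree. -/
abbrev diskTop (M : V) (m : ℕ) : (disk M m).X (m + 1) ≅ M :=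
  HomologicalComplex.doubleXIso₀ (𝟙 M) (down_rel_succ m)

/-- The object of a disk in its lower degree. -/
abbrev diskBot (M : V) (m : ℕ) : (disk M m).X m ≅ M :=
  HomologicalComplex.doubleXIso₁ (𝟙 M) (down_rel_succ m) m.succ_ne_self

lemma disk_d (M : V) (m : ℕ) :
    (disk M m).d (m + 1) m = (diskTop M m).hom ≫ (diskBot M m).inv := by
  rw [HomologicalComplex.double_d _ _ m.succ_ne_self, Category.id_comp]

lemma exists_disk_hom {M : V} {m : ℕ} {K : ChainComplex V ℕ} (φ : M ⟶ K.X (m + 1)) :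
    ∃ b : disk M m ⟶ K, b.f (m + 1) = (diskTop M m).hom ≫ φ :=
  ⟨HomologicalComplex.mkHomFromDouble _ m.succ_ne_self φ (φ ≫ K.d _ _) (by simp) (by simp),
    HomologicalComplex.mkHomFromDouble_f₀ ..⟩

lemma exists_hom_disk {M : V} {m : ℕ} {K : ChainComplex V ℕ} (φ : K.X m ⟶ M) :
    ∃ b : K ⟶ disk M m, b.f m = φ ≫ (diskBot M m).inv := by
  -- The differential of the disk is invertible, so compatibility with it forces the component in
  -- degree `m + 1` to be `K.d (m + 1) m ≫ φ`, up to the identifications.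
  refine ⟨{ f := fun k =>
              if h₀ : k = m + 1 then eqToHom (congrArg K.X h₀) ≫ K.d (m + 1) m ≫ φ ≫
                (diskTop M m).inv ≫ eqToHom (congrArg (disk M m).X h₀.symm)
              else if h₁ : k = m then eqToHom (congrArg K.X h₁) ≫ φ ≫
                (diskBot M m).inv ≫ eqToHom (congrArg (disk M m).X h₁.symm)
              else 0
            comm' := ?_ }, ?_⟩
  · intro i j hij
    obtain rfl : j + 1 = i := hij
    by_cases h₁ : j = m
    · subst h₁
      simp [disk_d]
    · rw [HomologicalComplex.double_d_eq_zero₁ _ _ _ _ h₁, Limits.comp_zero]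
      by_cases h₀ : j = m + 1
      · subst h₀
        simp
      · simp [h₀, h₁]
  · simp

lemma nonempty_homotopy_disk (M : V) (m : ℕ) : Nonempty (Homotopy 0 (𝟙 (disk M m))) := by
  -- The contraction is the inverse of the differential, placed in the single component from `m` to
  -- `m + 1`.
  have h : (𝟙 (disk M m)) = Homotopy.nullHomotopicMap (fun i j =>
      if h : i = m ∧ j = m + 1 then eqToHom (congrArg (disk M m).X h.1) ≫
        (diskBot M m).hom ≫ (diskTop M m).inv ≫ eqToHom (congrArg (disk M m).X h.2.symm)
      else 0) := by
    ext
    · rw [Homotopy.nullHomotopicMap_f (down_rel_succ (m + 1)) (down_rel_succ m)]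
      simp [disk_d]
    -- Here `m` may be `0`, with no degree below it. The `dNext` term vanishes in any case, so only
    -- `prevD` has to be unfolded.
    · change _ = dNext m _ + prevD m _
      rw [prevD_eq _ (down_rel_succ m)]
      simp [disk_d, dNext]
  rw [h]
  refine ⟨(Homotopy.nullHomotopy _ ?_).symm⟩
  intro i j hij
  rw [dif_neg]
  rintro ⟨rfl, rfl⟩
  exact hij rfl

/-- In a complex isomorphic to a disk, the only non-trivial component of a contraction is
invertible. -/
lemma isIso_of_homotopy_disk {M : V} {m : ℕ} {K : ChainComplex V ℕ} (ψ : K ≅ disk M m)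
    (h : Homotopy 0 (𝟙 K)) : IsIso (h.hom m (m + 1)) := by
  -- As the complex vanishes in degree `m + 2`, the homotopy relation in degree `m + 1` reads `0 = d
  -- ≫ h + 𝟙`, so `h` is minus the inverse of the differential.
  have h₁ := h.comm (m + 1)
  have hz : Limits.IsZero (K.X (m + 2)) :=
    (HomologicalComplex.isZero_double_X (𝟙 M) (down_rel_succ m) (m + 2) (by simp) (by simp)).of_iso
      ((HomologicalComplex.eval V (ComplexShape.down ℕ) (m + 2)).mapIso ψ)
  have hd : IsIso (K.d (m + 1) m) := by
    have : K.d (m + 1) m = ψ.hom.f (m + 1) ≫ (disk M m).d (m + 1) m ≫ ψ.inv.f m := by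
      rw [← ψ.inv.comm, ← HomologicalComplex.comp_f_assoc]
      simp
    rw [this, disk_d]
    infer_instance
  rw [dNext_eq _ (down_rel_succ m),
    prevD_eq _ (down_rel_succ (m + 1)), hz.eq_of_src (K.d _ _) 0,
    Limits.comp_zero, add_zero] at h₁
  have h₂ : h.hom m (m + 1) = -inv (K.d (m + 1) m) := by
    rw [← cancel_epi (K.d (m + 1) m), Preadditive.comp_neg, IsIso.hom_inv_id]
    exact (neg_eq_of_add_eq_zero_left (by simpa using h₁.symm)).symm
  rw [h₂]
  exact ⟨-K.d (m + 1) m, by simp, by simp⟩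

end Disk

variable {R : Type u} [Ring R]

/-! ### The cylinder -/

section Cylinder

lemma tensorInterval_hom_ext {A : SMod.{v} R} {n : SimplexCategoryᵒᵖ} {P : ModuleCat.{v} R}
    {f g : (tensor A interval).obj n ⟶ P}
    (h : ∀ (a : A.obj n) (x : (SSet.stdSimplex.{v}.obj ⦋1⦌).obj n),
      f.hom ((a ⊗ₜ[ℤ] FreeAbelianGroup.of x :) : A.obj n ⊗[ℤ] interval.obj n) =
        g.hom ((a ⊗ₜ[ℤ] FreeAbelianGroup.of x :) : A.obj n ⊗[ℤ] interval.obj n)) : f = g := by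
  refine modTensor_hom_ext fun a b => ?_
  let F (k : (tensor A interval).obj n ⟶ P) :
      FreeAbelianGroup ((SSet.stdSimplex.{v}.obj ⦋1⦌).obj n) →+ P :=
    k.hom.toAddMonoidHom.comp
      (TensorProduct.mk ℤ (A.obj n) (interval.{v}.obj n) a).toAddMonoidHom
  have : F f = F g := FreeAbelianGroup.lift_ext _ _ fun x => h a x
  exact DFunLike.congr_fun this (b : FreeAbelianGroup ((SSet.stdSimplex.{v}.obj ⦋1⦌).obj n))

/-- The map `a ↦ a ⊗ x` for a simplex `x` of `Δ[1]`. -/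
def tensorSimplex (A : SMod.{v} R) {n : SimplexCategoryᵒᵖ}
    (x : (SSet.stdSimplex.{v}.obj ⦋1⦌).obj n) : A.obj n ⟶ (tensor A interval).obj n :=
  ModuleCat.ofHom (X := A.obj n) (Y := (tensor A interval).obj n)
    { toFun := fun a => (a ⊗ₜ[ℤ] FreeAbelianGroup.of x : A.obj n ⊗[ℤ] interval.obj n)
      map_add' := fun a b => TensorProduct.add_tmul a b _
      map_smul' := fun r a => (TensorProduct.smul_tmul' r a _).symm }

lemma tensorInterval_hom_ext' {A : SMod.{v} R} {n : SimplexCategoryᵒᵖ} {P : ModuleCat.{v} R}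
    {f g : (tensor A interval).obj n ⟶ P}
    (h : ∀ x, tensorSimplex A x ≫ f = tensorSimplex A x ≫ g) : f = g :=
  tensorInterval_hom_ext fun a x => ConcreteCategory.congr_hom (h x) a

lemma tensorSimplex_map (A : SMod.{v} R) {n m : SimplexCategoryᵒᵖ}
    (x : (SSet.stdSimplex.{v}.obj ⦋1⦌).obj n) (θ : n ⟶ m) :
    tensorSimplex A x ≫ (tensor A interval).map θ =
      A.map θ ≫ tensorSimplex A ((SSet.stdSimplex.{v}.obj ⦋1⦌).map θ x) :=
  rfl

lemma cylinderEnd_app (e : Fin 2) (A : SMod.{v} R) (n : SimplexCategoryᵒᵖ) :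
    (cylinderEnd e A).app n = tensorSimplex A (SSet.stdSimplex.const 1 e n) :=
  rfl

/-- The map `A_n ⊗ (ℤΔ¹)_n ⟶ A_n` induced by an additive function on `(ℤΔ¹)_n`. -/
def contract (A : SMod.{v} R) {n : SimplexCategoryᵒᵖ}
    (χ : (SSet.stdSimplex.{v}.obj ⦋1⦌).obj n → ℤ) : (tensor A interval).obj n ⟶ A.obj n :=
  ModuleCat.ofHom (X := (tensor A interval).obj n) (Y := A.obj n)
    (TensorProduct.AlgebraTensorModule.lift (R := ℤ) (A := R) (M := A.obj n)
      (N := interval.{v}.obj n) (P := A.obj n)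
      { toFun := fun a => (LinearMap.toSpanSingleton ℤ (A.obj n) a).comp
          (AddMonoidHom.toIntLinearMap (M := interval.{v}.obj n) (FreeAbelianGroup.lift χ))
        map_add' := fun a b => LinearMap.ext fun x => smul_add (FreeAbelianGroup.lift χ x) a b
        map_smul' := fun r a => LinearMap.ext fun x => smul_comm (FreeAbelianGroup.lift χ x) r a })

lemma tensorSimplex_contract (A : SMod.{v} R) {n : SimplexCategoryᵒᵖ}
    (x : (SSet.stdSimplex.{v}.obj ⦋1⦌).obj n) (χ : (SSet.stdSimplex.{v}.obj ⦋1⦌).obj n → ℤ) :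
    tensorSimplex A x ≫ contract A χ = χ x • 𝟙 (A.obj n) := by
  ext a
  exact congrArg (· • a) (FreeAbelianGroup.lift_apply_of χ x)

/-- The projection of the cylinder. -/
def cylinderProj (A : SMod.{v} R) : tensor A interval ⟶ A where
  app n := contract A fun _ => 1
  naturality n m θ := by
    apply tensorInterval_hom_ext'
    intro x
    rw [reassoc_of% tensorSimplex_map, tensorSimplex_contract, reassoc_of% tensorSimplex_contract]
    simp

@[simp]
lemma cylinderEnd_cylinderProj (e : Fin 2) (A : SMod.{v} R) :
    cylinderEnd e A ≫ cylinderProj A = 𝟙 A := by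
  refine NatTrans.ext (funext fun n => ?_)
  refine (tensorSimplex_contract A _ _).trans ?_
  simp

/-- The functoriality of the cylinder. -/
def cylinderMap {A B : SMod.{v} R} (f : A ⟶ B) : tensor A interval ⟶ tensor B interval where
  app n := modTensorHom (f.app n) (𝟙 _)
  naturality n m θ := by
    change modTensorHom (A.map θ) (interval.map θ) ≫ modTensorHom (f.app m) (𝟙 _) =
      modTensorHom (f.app n) (𝟙 _) ≫ modTensorHom (B.map θ) (interval.map θ)
    rw [← modTensorHom_comp, ← modTensorHom_comp, f.naturality, Category.id_comp,
      Category.comp_id]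

/-- The minimum of two simplices of `Δ[1]`. -/
def meet {n : SimplexCategoryᵒᵖ} (x y : (SSet.stdSimplex.{v}.obj ⦋1⦌).obj n) :
    (SSet.stdSimplex.{v}.obj ⦋1⦌).obj n :=
  SSet.stdSimplex.objEquiv.symm (SimplexCategory.Hom.mk
    ((SSet.stdSimplex.objEquiv x).toOrderHom ⊓ (SSet.stdSimplex.objEquiv y).toOrderHom))

lemma map_meet {n m : SimplexCategoryᵒᵖ} (θ : n ⟶ m)
    (x y : (SSet.stdSimplex.{v}.obj ⦋1⦌).obj n) :
    (SSet.stdSimplex.{v}.obj ⦋1⦌).map θ (meet x y) =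
      meet ((SSet.stdSimplex.{v}.obj ⦋1⦌).map θ x) ((SSet.stdSimplex.{v}.obj ⦋1⦌).map θ y) :=
  rfl

lemma stdSimplex_one_ext {n : SimplexCategoryᵒᵖ} {x y : (SSet.stdSimplex.{v}.obj ⦋1⦌).obj n}
    (h : ∀ j, (SSet.stdSimplex.objEquiv x).toOrderHom j =
      (SSet.stdSimplex.objEquiv y).toOrderHom j) : x = y :=
  SSet.stdSimplex.objEquiv.injective (SimplexCategory.Hom.ext _ _ (OrderHom.ext _ _ (funext h)))

lemma meet_comm {n : SimplexCategoryᵒᵖ} (x y : (SSet.stdSimplex.{v}.obj ⦋1⦌).obj n) :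
    meet x y = meet y x :=
  stdSimplex_one_ext fun _ => inf_comm _ _

lemma meet_zero {n : SimplexCategoryᵒᵖ} (x : (SSet.stdSimplex.{v}.obj ⦋1⦌).obj n) :
    meet x (SSet.stdSimplex.const 1 0 n) = SSet.stdSimplex.const 1 0 n :=
  stdSimplex_one_ext fun _ => inf_eq_right.2 (Fin.zero_le _)

lemma meet_one {n : SimplexCategoryᵒᵖ} (x : (SSet.stdSimplex.{v}.obj ⦋1⦌).obj n) :
    meet x (SSet.stdSimplex.const 1 1 n) = x :=
  stdSimplex_one_ext fun _ => inf_eq_left.2 (Fin.le_last _)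

/-- The bilinear extension of the minimum. -/
def meetHom (n : SimplexCategoryᵒᵖ) :
    interval.{v}.obj n ⊗[ℤ] interval.{v}.obj n →ₗ[ℤ] interval.{v}.obj n :=
  TensorProduct.lift (AddMonoidHom.toIntLinearMap (M := interval.{v}.obj n)
    (FreeAbelianGroup.lift fun x => AddMonoidHom.toIntLinearMap (M := interval.{v}.obj n)
      (M₂ := interval.{v}.obj n) (FreeAbelianGroup.map (meet x))))

lemma meetHom_of_tmul_of {n : SimplexCategoryᵒᵖ} (x y : (SSet.stdSimplex.{v}.obj ⦋1⦌).obj n) :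
    meetHom n ((FreeAbelianGroup.of x :) ⊗ₜ[ℤ] (FreeAbelianGroup.of y :)) =
      FreeAbelianGroup.of (meet x y) := by
  refine (TensorProduct.lift.tmul _ _).trans ?_
  refine (LinearMap.congr_fun (FreeAbelianGroup.lift_apply_of _ x) _).trans ?_
  exact FreeAbelianGroup.map_of_apply ..

/-- The map `A_n ⊗ (ℤΔ¹)_n ⊗ (ℤΔ¹)_n ⟶ A_n ⊗ (ℤΔ¹)_n` induced by the minimum. -/
def cylinderMeetApp (A : SMod.{v} R) (n : SimplexCategoryᵒᵖ) :
    (tensor (tensor A interval) interval).obj n ⟶ (tensor A interval).obj n :=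
  ModuleCat.ofHom (X := (tensor (tensor A interval) interval).obj n)
    (Y := (tensor A interval).obj n)
    ((TensorProduct.AlgebraTensorModule.map (LinearMap.id (R := R) (M := A.obj n))
      (meetHom.{v} n)).comp (TensorProduct.AlgebraTensorModule.assoc ℤ ℤ R (A.obj n)
        (interval.{v}.obj n) (interval.{v}.obj n)).toLinearMap)

lemma tensorSimplex_cylinderMeetApp (A : SMod.{v} R) {n : SimplexCategoryᵒᵖ}
    (x y : (SSet.stdSimplex.{v}.obj ⦋1⦌).obj n) :
    tensorSimplex A x ≫ tensorSimplex (tensor A interval) y ≫ cylinderMeetApp A n =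
      tensorSimplex A (meet x y) := by
  ext a
  exact congrArg (a ⊗ₜ[ℤ] ·) (meetHom_of_tmul_of x y)

/-- The deformation of the cylinder onto its end `0`. -/
def cylinderMeet (A : SMod.{v} R) : tensor (tensor A interval) interval ⟶ tensor A interval where
  app n := cylinderMeetApp A n
  naturality n m θ := by
    apply tensorInterval_hom_ext'
    intro y
    apply tensorInterval_hom_ext'
    intro x
    rw [reassoc_of% tensorSimplex_map, reassoc_of% tensorSimplex_map, tensorSimplex_cylinderMeetApp,
      reassoc_of% tensorSimplex_cylinderMeetApp, tensorSimplex_map, map_meet]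

lemma cylinderEnd_zero_cylinderMeet (A : SMod.{v} R) :
    cylinderEnd 0 (tensor A interval) ≫ cylinderMeet A = cylinderProj A ≫ cylinderEnd 0 A := by
  refine NatTrans.ext (funext fun n => ?_)
  apply tensorInterval_hom_ext'
  intro x
  refine (tensorSimplex_cylinderMeetApp A x _).trans ?_
  refine Eq.trans ?_ ((reassoc_of% tensorSimplex_contract A x) _ _).symm
  rw [meet_zero, one_smul, Category.id_comp]
  rfl

lemma cylinderEnd_one_cylinderMeet (A : SMod.{v} R) :
    cylinderEnd 1 (tensor A interval) ≫ cylinderMeet A = 𝟙 _ := by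
  refine NatTrans.ext (funext fun n => ?_)
  apply tensorInterval_hom_ext'
  intro x
  refine (tensorSimplex_cylinderMeetApp A x _).trans ?_
  rw [meet_one]
  exact (Category.comp_id _).symm

/-- Now the homotopy parameter is the inner copy of the interval and the outer one is free. This is
the form needed after currying the outer copy, for the deformation of the path object. -/
lemma cylinderMap_end_zero_cylinderMeet (A : SMod.{v} R) :
    cylinderMap (cylinderEnd 0 A) ≫ cylinderMeet A = cylinderProj A ≫ cylinderEnd 0 A := by
  refine NatTrans.ext (funext fun n => ?_)
  apply tensorInterval_hom_ext'
  intro x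
  refine (tensorSimplex_cylinderMeetApp A _ x).trans ?_
  refine Eq.trans ?_ ((reassoc_of% tensorSimplex_contract A x) _ _).symm
  rw [meet_comm, meet_zero, one_smul, Category.id_comp]
  rfl

lemma cylinderMap_end_one_cylinderMeet (A : SMod.{v} R) :
    cylinderMap (cylinderEnd 1 A) ≫ cylinderMeet A = 𝟙 _ := by
  refine NatTrans.ext (funext fun n => ?_)
  apply tensorInterval_hom_ext'
  intro x
  refine (tensorSimplex_cylinderMeetApp A _ x).trans ?_
  rw [meet_comm, meet_one]
  exact (Category.comp_id _).symm

lemma cylinderMap_cylinderProj {A B : SMod.{v} R} (f : A ⟶ B) :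
    cylinderMap f ≫ cylinderProj B = cylinderProj A ≫ f := by
  refine NatTrans.ext (funext fun n => ?_)
  apply tensorInterval_hom_ext'
  intro x
  refine (congrArg (f.app n ≫ ·) (tensorSimplex_contract B x _)).trans ?_
  refine Eq.trans ?_ ((reassoc_of% tensorSimplex_contract A x) _ _).symm
  simp

end Cylinder

/-! ### The chain homotopy between the ends of the cylinder -/

section ChainHomotopy

lemma tensorSimplex_δ (A : SMod.{v} R) {n : ℕ} (x : (Δ[1] : SSet.{v}) _⦋n + 1⦌) (j : Fin (n + 2)) :
    tensorSimplex A x ≫ (tensor A interval).δ j =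
      A.δ j ≫ tensorSimplex A ((Δ[1] : SSet.{v}).δ j x) :=
  rfl

lemma tensorSimplex_σ (A : SMod.{v} R) {n : ℕ} (x : (Δ[1] : SSet.{v}) _⦋n⦌) (j : Fin (n + 1)) :
    tensorSimplex A x ≫ (tensor A interval).σ j =
      A.σ j ≫ tensorSimplex A ((Δ[1] : SSet.{v}).σ j x) :=
  rfl

open SSet.stdSimplex in
/-- The combinatorial homotopy between the two ends of the cylinder. -/
def cylinderHomotopy (A : SMod.{v} R) :
    SimplicialObject.Homotopy (cylinderEnd 0 A) (cylinderEnd 1 A) where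
  -- This simplex of `Δ[1]` sends the vertices `0, …, i` to `0` and the others to `1`; paired with
  -- `σ i` it is the `i`-th top simplex of the prism.
  h {n} i := A.σ i ≫ tensorSimplex A (objMk₁ i.succ.castSucc)
  h_zero_comp_δ_zero n := by
    have hx : (Δ[1] : SSet.{v}).δ 0 (objMk₁ (0 : Fin (n + 1)).succ.castSucc) =
        const 1 1 (op ⦋n⦌) :=
      δ_objMk₁_of_lt _ _ (by simp)
    have hσ : A.σ (0 : Fin (n + 1)) ≫ A.δ 0 = 𝟙 _ := A.δ_comp_σ_self
    rw [Category.assoc, tensorSimplex_δ, ← Category.assoc, hx, hσ, Category.id_comp,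
      cylinderEnd_app]
  h_last_comp_δ_last n := by
    have hx : (Δ[1] : SSet.{v}).δ (Fin.last (n + 1)) (objMk₁ (Fin.last n).succ.castSucc) =
        const 1 0 (op ⦋n⦌) := by
      rw [δ_objMk₁_of_le _ _ (by simp)]
      ext k : 1
      exact objMk₁_of_castSucc_lt _ _ k.castSucc_lt_last
    rw [Category.assoc, tensorSimplex_δ, ← Category.assoc, hx, ← Fin.succ_last,
      A.δ_comp_σ_succ, Category.id_comp, cylinderEnd_app]
  h_succ_comp_δ_castSucc_of_lt i j hij := by
    rw [Category.assoc, tensorSimplex_δ, ← Category.assoc, ← Category.assoc,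
      A.δ_comp_σ_of_le hij, δ_objMk₁_of_lt _ _ (by grind)]
    rfl
  h_succ_comp_δ_castSucc_succ {n} j := by
    -- Consecutive prism simplices differ only in the value at vertex `j + 1`, so they agree on the
    -- face that omits it.
    have hx : (Δ[1] : SSet.{v}).δ j.castSucc.succ (objMk₁ j.succ.succ.castSucc) =
        (Δ[1] : SSet.{v}).δ j.castSucc.succ (objMk₁ j.castSucc.succ.castSucc) := by
      rw [δ_objMk₁_of_lt _ _ (by grind), δ_objMk₁_of_le _ _ (by grind)]
      rfl
    have hσ : A.σ j.succ ≫ A.δ j.castSucc.succ = 𝟙 _ := by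
      rw [Fin.succ_castSucc, A.δ_comp_σ_self]
    rw [Category.assoc, Category.assoc, tensorSimplex_δ, tensorSimplex_δ, ← Category.assoc,
      ← Category.assoc, A.δ_comp_σ_succ, hσ, hx]
  h_castSucc_comp_δ_succ_of_lt i j hji := by
    rw [Category.assoc, tensorSimplex_δ, ← Category.assoc, ← Category.assoc,
      A.δ_comp_σ_of_gt hji, δ_objMk₁_of_le _ _ (by grind)]
    rfl
  h_comp_σ_castSucc_of_le i j hij := by
    rw [Category.assoc, tensorSimplex_σ, ← Category.assoc, ← Category.assoc,
      A.σ_comp_σ hij, σ_objMk₁_of_lt _ _ (by grind)]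
    rfl
  h_comp_σ_succ_of_lt i j hji := by
    rw [Category.assoc, tensorSimplex_σ, ← Category.assoc, ← Category.assoc,
      ← A.σ_comp_σ hji, σ_objMk₁_of_le _ _ (by grind)]
    rfl

open AlgebraicTopology AlgebraicTopology.DoldKan

/-- The normalized complex is a natural retract of the alternating face map complex. Chain
homotopies on the latter can therefore be compressed to the former. -/
lemma normalization_map_eq {A B : SMod.{v} R} (f : A ⟶ B) :
    (normalization R).map f = inclusionOfMooreComplexMap A ≫
      (alternatingFaceMapComplex _).map f ≫ PInftyToNormalizedMooreComplex B := by
  have h := PInftyToNormalizedMooreComplex_naturality f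
  refine Eq.trans ?_ (congrArg (inclusionOfMooreComplexMap A ≫ ·) h).symm
  exact ((splitMonoInclusionOfMooreComplexMap A).id_assoc _).symm

/-- The chain homotopy between the two ends of the cylinder. -/
def normalizedCylinderHomotopy (A : SMod.{v} R) :
    Homotopy ((normalization R).map (cylinderEnd 0 A)) ((normalization R).map (cylinderEnd 1 A)) :=
  (Homotopy.ofEq (normalization_map_eq _)).trans
    ((((cylinderHomotopy A).toChainHomotopy.compRight _).compLeft _).trans
      (Homotopy.ofEq (normalization_map_eq _).symm))

/-- The chain homotopy induced by a map out of the cylinder. -/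
def normalizedHomotopy {A B : SMod.{v} R} {f g : A ⟶ B} (H : tensor A interval ⟶ B)
    (h₀ : cylinderEnd 0 A ≫ H = f) (h₁ : cylinderEnd 1 A ≫ H = g) :
    Homotopy ((normalization R).map f) ((normalization R).map g) :=
  (Homotopy.ofEq (by rw [← h₀, Functor.map_comp])).trans
    (((normalizedCylinderHomotopy A).compRight ((normalization R).map H)).trans
      (Homotopy.ofEq (by rw [← h₁, Functor.map_comp])))

/-- The chain homotopy is natural in `H`: its first factor depends only on `A`. This lets an
equation between maps out of the cylinder be read off on homotopy components. -/
lemma normalizedHomotopy_hom {A B : SMod.{v} R} {f g : A ⟶ B} (H : tensor A interval ⟶ B)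
    (h₀ : cylinderEnd 0 A ≫ H = f) (h₁ : cylinderEnd 1 A ≫ H = g) (i j : ℕ) :
    (normalizedHomotopy H h₀ h₁).hom i j =
      (normalizedCylinderHomotopy A).hom i j ≫ ((normalization R).map H).f j := by
  simp [normalizedHomotopy]

lemma const_zero_ne_const_one (n : SimplexCategoryᵒᵖ) :
    SSet.stdSimplex.const.{v} 1 0 n ≠ SSet.stdSimplex.const 1 1 n := fun h =>
  zero_ne_one (α := Fin 2) (congrArg (fun x => (SSet.stdSimplex.objEquiv x).toOrderHom 0) h)

lemma exists_normalized_retraction (A : SMod.{v} R) (n : ℕ) :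
    ∃ r : ((normalization R).obj (tensor A interval)).X n ⟶ ((normalization R).obj A).X n,
      ((normalization R).map (cylinderEnd 0 A)).f n ≫ r = 0 ∧
        ((normalization R).map (cylinderEnd 1 A)).f n ≫ r = 𝟙 _ := by
  let I (B : SMod.{v} R) : ((normalization R).obj B).X n ⟶ B.obj (op ⦋n⦌) :=
    (inclusionOfMooreComplexMap B).f n
  let P : A.obj (op ⦋n⦌) ⟶ ((normalization R).obj A).X n := (PInftyToNormalizedMooreComplex A).f n
  have key (e : Fin 2) : ((normalization R).map (cylinderEnd e A)).f n ≫ I _ =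
      I A ≫ (cylinderEnd e A).app (op ⦋n⦌) :=
    HomologicalComplex.congr_hom
      ((inclusionOfMooreComplex (ModuleCat.{v} R)).naturality (cylinderEnd e A)) n
  have hid : I A ≫ P = 𝟙 _ :=
    HomologicalComplex.congr_hom (splitMonoInclusionOfMooreComplexMap A).id n
  -- The two constant simplices are distinct basis elements of `(ℤΔ¹)_n`, so a coordinate function
  -- separates the ends. The resulting map need not commute with the simplicial operators; only its
  -- value in degree `n` matters.
  let χ : (SSet.stdSimplex.{v}.obj ⦋1⦌).obj (op ⦋n⦌) → ℤ :=
    fun x => if x = SSet.stdSimplex.const 1 1 _ then 1 else 0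
  refine ⟨I _ ≫ contract A χ ≫ P, ?_, ?_⟩
  · rw [reassoc_of% key 0, cylinderEnd_app, reassoc_of% tensorSimplex_contract,
      show χ _ = 0 from if_neg (const_zero_ne_const_one _), zero_smul, Limits.zero_comp,
      Limits.comp_zero]
  · rw [reassoc_of% key 1, cylinderEnd_app, reassoc_of% tensorSimplex_contract,
      show χ _ = 1 from if_pos rfl, one_smul, Category.id_comp, hid]

/-- Fullness and faithfulness bring chain-level fillers back to simplicial modules; essential
surjectivity provides the simplicial disks. -/
instance : (normalization.{v} R).IsEquivalence :=
  inferInstanceAs (Abelian.DoldKan.equivalence (A := ModuleCat.{v} R)).functor.IsEquivalence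

/-- Simplicial homotopies correspond to chain homotopies under the Dold-Kan correspondence. -/
lemma homotopic_iff {A B : SMod.{v} R} (f g : A ⟶ B) :
    Homotopic f g ↔ Nonempty (Homotopy ((normalization R).map f) ((normalization R).map g)) := by
  constructor
  · rintro ⟨H, h₀, h₁⟩
    exact ⟨normalizedHomotopy H h₀ h₁⟩
  · rintro ⟨h⟩
    choose r hr₀ hr₁ using exists_normalized_retraction A
    obtain ⟨G, hG₀, hG₁⟩ := exists_hom_of_homotopy
      (ι₀ := (normalization R).map (cylinderEnd 0 A))
      (ι₁ := (normalization R).map (cylinderEnd 1 A))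
      (σ := (normalization R).map (cylinderProj A))
      (by rw [← Functor.map_comp, cylinderEnd_cylinderProj, CategoryTheory.Functor.map_id])
      (by rw [← Functor.map_comp, cylinderEnd_cylinderProj, CategoryTheory.Functor.map_id])
      r hr₀ hr₁ h
    refine ⟨(normalization R).preimage G, ?_, ?_⟩
    · apply (normalization R).map_injective
      rw [Functor.map_comp, Functor.map_preimage, hG₀]
    · apply (normalization R).map_injective
      rw [Functor.map_comp, Functor.map_preimage, hG₁]

end ChainHomotopy

/-! ### The path object -/

section PathObject

/-- The map `ℤΔ[k] ⟶ A` which corresponds to a `k`-simplex of `A`. -/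
def simplexMap (A : SMod.{v} R) {k : SimplexCategoryᵒᵖ} (a : A.obj k) :
    simplexAb.{v}.obj k.unop ⟶ (forgetAb R).obj A where
  app m := AddCommGrpCat.ofHom (X := (simplexAb.{v}.obj k.unop).obj m) (Y := A.obj m)
    (FreeAbelianGroup.lift fun θ => (A.map (SSet.stdSimplex.objEquiv θ).op).hom a)
  naturality m m' φ := by
    apply AddCommGrpCat.hom_ext
    refine FreeAbelianGroup.lift_ext _ _ fun θ => ?_
    refine (FreeAbelianGroup.lift_apply_of _ _).trans ?_
    refine Eq.trans ?_
      (congrArg (A.map φ).hom (FreeAbelianGroup.lift_apply_of _ θ).symm)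
    exact ConcreteCategory.congr_hom (A.map_comp (SSet.stdSimplex.objEquiv θ).op φ) a

lemma simplexMap_of (A : SMod.{v} R) {k m : SimplexCategoryᵒᵖ} (a : A.obj k)
    (θ : (SSet.stdSimplex.{v}.obj k.unop).obj m) :
    ((simplexMap A a).app m).hom (FreeAbelianGroup.of θ :) =
      (A.map (SSet.stdSimplex.objEquiv θ).op).hom a :=
  FreeAbelianGroup.lift_apply_of _ _

lemma simplexMap_add (A : SMod.{v} R) {k : SimplexCategoryᵒᵖ} (a b : A.obj k) :
    simplexMap A (a + b) = simplexMap A a + simplexMap A b := by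
  refine NatTrans.ext (funext fun m => AddCommGrpCat.hom_ext ?_)
  refine FreeAbelianGroup.lift_ext _ _ fun θ => ?_
  refine (simplexMap_of A _ θ).trans ((map_add _ a b).trans ?_)
  exact (congrArg₂ _ (simplexMap_of A a θ) (simplexMap_of A b θ)).symm

lemma simplexMap_smul (A : SMod.{v} R) {k : SimplexCategoryᵒᵖ} (r : R) (a : A.obj k) :
    simplexMap A (r • a) = simplexMap A a ≫ scalar A r := by
  refine NatTrans.ext (funext fun m => AddCommGrpCat.hom_ext ?_)
  refine FreeAbelianGroup.lift_ext _ _ fun θ => ?_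
  have h : (A.map (SSet.stdSimplex.objEquiv θ).op).hom (r • a) = r • _ := map_smul _ r a
  refine (simplexMap_of A _ θ).trans (h.trans ?_)
  exact (congrArg (DistribSMul.toAddMonoidHom (A.obj m) r) (simplexMap_of A a θ)).symm

lemma simplexMap_map (A : SMod.{v} R) {k l : SimplexCategoryᵒᵖ} (φ : k ⟶ l) (a : A.obj k) :
    simplexMap A ((A.map φ).hom a) = simplexAb.map φ.unop ≫ simplexMap A a := by
  refine NatTrans.ext (funext fun m => AddCommGrpCat.hom_ext ?_)
  refine FreeAbelianGroup.lift_ext _ _ fun θ => ?_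
  refine (simplexMap_of A _ θ).trans ?_
  refine Eq.trans ?_ (simplexMap_of A a ((SSet.stdSimplex.{v}.map φ.unop).app m θ)).symm
  exact (ConcreteCategory.congr_hom (A.map_comp φ (SSet.stdSimplex.objEquiv θ).op) a).symm

lemma simplexMap_comp {A B : SMod.{v} R} (f : A ⟶ B) {k : SimplexCategoryᵒᵖ} (a : A.obj k) :
    simplexMap A a ≫ (forgetAb R).map f = simplexMap B ((f.app k).hom a) := by
  refine NatTrans.ext (funext fun m => AddCommGrpCat.hom_ext ?_)
  refine FreeAbelianGroup.lift_ext _ _ fun θ => ?_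
  refine Eq.trans (congrArg (f.app m).hom (simplexMap_of A a θ)) ?_
  refine Eq.trans ?_ (simplexMap_of B _ θ).symm
  exact ConcreteCategory.congr_hom (f.naturality (SSet.stdSimplex.objEquiv θ).op) a

/-- The exchange of the factors, as a map to the abelian groups underlying the tensoring. -/
def swapTensor {A : SMod.{v} R} {L : SAb.{v}} (K : SAb.{v}) (φ : L ⟶ (forgetAb R).obj A) :
    abTensor K L ⟶ (forgetAb R).obj (tensor A K) where
  app m := AddCommGrpCat.ofHom (X := (abTensor K L).obj m) (Y := (tensor A K).obj m)
    ((TensorProduct.map (AddMonoidHom.toIntLinearMap (M₂ := A.obj m) (φ.app m).hom)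
      LinearMap.id).comp
        (TensorProduct.comm ℤ (K.obj m) (L.obj m)).toLinearMap).toAddMonoidHom
  naturality m m' θ := by
    refine grpTensor_hom_ext fun a b => ?_
    exact congrArg (fun z : A.obj m' => (z ⊗ₜ[ℤ] (K.map θ).hom a : A.obj m' ⊗[ℤ] K.obj m'))
      (ConcreteCategory.congr_hom (φ.naturality θ) b)

lemma abTensor_hom_ext {K L M : SAb.{v}} {f g : abTensor K L ⟶ M}
    (h : ∀ (m : SimplexCategoryᵒᵖ) (x : K.obj m) (y : L.obj m),
      (f.app m).hom ((x ⊗ₜ[ℤ] y :) : K.obj m ⊗[ℤ] L.obj m) =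
        (g.app m).hom ((x ⊗ₜ[ℤ] y :) : K.obj m ⊗[ℤ] L.obj m)) : f = g :=
  NatTrans.ext (funext fun m => grpTensor_hom_ext (h m))

lemma swapTensor_add {A : SMod.{v} R} {L : SAb.{v}} (K : SAb.{v})
    (φ ψ : L ⟶ (forgetAb R).obj A) :
    swapTensor K (φ + ψ) = swapTensor K φ + swapTensor K ψ :=
  abTensor_hom_ext fun m x y =>
    TensorProduct.add_tmul (R := ℤ) (M := A.obj m) ((φ.app m).hom y) ((ψ.app m).hom y) x

lemma swapTensor_scalar {A : SMod.{v} R} {L : SAb.{v}} (K : SAb.{v})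
    (φ : L ⟶ (forgetAb R).obj A) (r : R) :
    swapTensor K (φ ≫ scalar A r) = swapTensor K φ ≫ scalar (tensor A K) r :=
  abTensor_hom_ext fun _ _ _ => rfl

lemma swapTensor_comp {A : SMod.{v} R} {L L' : SAb.{v}} (K : SAb.{v}) (g : L ⟶ L')
    (φ : L' ⟶ (forgetAb R).obj A) :
    swapTensor K (g ≫ φ) = abTensorMap K g ≫ swapTensor K φ :=
  abTensor_hom_ext fun _ _ _ => rfl

lemma swapTensor_cylinderMap {A B : SMod.{v} R} {L : SAb.{v}} (φ : L ⟶ (forgetAb R).obj A)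
    (f : A ⟶ B) :
    swapTensor interval φ ≫ (forgetAb R).map (cylinderMap f) =
      swapTensor interval (φ ≫ (forgetAb R).map f) :=
  abTensor_hom_ext fun _ _ _ => rfl

lemma scalar_naturality {A B : SMod.{v} R} (f : A ⟶ B) (r : R) :
    scalar A r ≫ (forgetAb R).map f = (forgetAb R).map f ≫ scalar B r :=
  NatTrans.ext (funext fun n => AddCommGrpCat.hom_ext (AddMonoidHom.ext fun a =>
    map_smul (f.app n).hom r (show A.obj n from a)))

/-- The map `ℤΔ¹ ⊗ ℤΔ[k] ⟶ B` obtained from a map out of the cylinder of `A` and a simplex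
of `A`. -/
def curryObj {A B : SMod.{v} R} (F : tensor A interval ⟶ B) {k : SimplexCategoryᵒᵖ}
    (a : A.obj k) : abTensor interval (simplexAb.{v}.obj k.unop) ⟶ (forgetAb R).obj B :=
  swapTensor interval (simplexMap A a) ≫ (forgetAb R).map F

/-- The map into the path object which corresponds to a map out of the cylinder. -/
def curry {A B : SMod.{v} R} (F : tensor A interval ⟶ B) : A ⟶ cotensor B interval where
  app k := ModuleCat.ofHom (X := A.obj k) (Y := (cotensor B interval).obj k)
    { toFun := fun a => curryObj F a
      map_add' := fun a b => by
        rw [curryObj, simplexMap_add, swapTensor_add, Preadditive.add_comp]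
        rfl
      map_smul' := fun r a => by
        rw [curryObj, simplexMap_smul, swapTensor_scalar, Category.assoc, scalar_naturality]
        rfl }
  naturality k l φ := by
    refine ModuleCat.hom_ext (LinearMap.ext fun a => ?_)
    change curryObj F ((A.map φ).hom a) =
      abTensorMap interval (simplexAb.map φ.unop) ≫ curryObj F a
    rw [curryObj, simplexMap_map, swapTensor_comp, Category.assoc]
    rfl

lemma curry_pathEval {A B : SMod.{v} R} (F : tensor A interval ⟶ B) (e : Fin 2) :
    curry F ≫ pathEval e B = cylinderEnd e A ≫ F := by
  refine NatTrans.ext (funext fun k => ModuleCat.hom_ext (LinearMap.ext fun a => ?_))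
  refine congrArg (fun z : A.obj k =>
    (F.app k).hom (z ⊗ₜ[ℤ] vertex e k : A.obj k ⊗[ℤ] interval.obj k)) ?_
  refine (simplexMap_of A a _).trans ?_
  exact ConcreteCategory.congr_hom (A.map_id k) a

/-- Naturality of the adjunction between tensoring and cotensoring with `ℤΔ¹`. Together with
`curry_evalPath` it is what the deformation of the path object uses to compute its two ends. -/
lemma comp_curry {A A' B : SMod.{v} R} (j : A ⟶ A') (F : tensor A' interval ⟶ B) :
    j ≫ curry F = curry (cylinderMap j ≫ F) := by
  refine NatTrans.ext (funext fun k => ModuleCat.hom_ext (LinearMap.ext fun a => ?_))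
  change curryObj F ((j.app k).hom a) = curryObj (cylinderMap j ≫ F) a
  rw [curryObj, ← simplexMap_comp, ← swapTensor_cylinderMap, Category.assoc,
    ← Functor.map_comp]
  rfl

/-- The evaluation `B ^ ℤΔ¹ ⊗ ℤΔ¹ ⟶ B`. -/
def evalPath (B : SMod.{v} R) : tensor (cotensor B interval) interval ⟶ B where
  app n := ModuleCat.ofHom (X := (tensor (cotensor B interval) interval).obj n) (Y := B.obj n)
    (TensorProduct.AlgebraTensorModule.lift (R := ℤ) (A := R)
      (M := (cotensor B interval).obj n) (N := interval.{v}.obj n) (P := B.obj n)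
      { toFun := fun (f : abTensor interval (simplexAb.obj n.unop) ⟶ (forgetAb R).obj B) =>
          (AddMonoidHom.toIntLinearMap (M₂ := B.obj n) (f.app n).hom).comp
            ((TensorProduct.mk ℤ (interval.{v}.obj n) ((simplexAb.{v}.obj n.unop).obj n)).flip
              (topSimplex n))
        map_add' := fun f g => rfl
        map_smul' := fun r f => rfl })
  naturality n m θ := by
    refine modTensor_hom_ext fun f x => ?_
    let f' : abTensor interval (simplexAb.obj n.unop) ⟶ (forgetAb R).obj B := f
    refine Eq.trans ?_ (ConcreteCategory.congr_hom (f'.naturality θ)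
      (x ⊗ₜ[ℤ] topSimplex n : interval.{v}.obj n ⊗[ℤ] (simplexAb.{v}.obj n.unop).obj n))
    exact congrArg (fun z : (simplexAb.{v}.obj n.unop).obj m => (f'.app m).hom
      ((interval.map θ).hom x ⊗ₜ[ℤ] z : interval.{v}.obj m ⊗[ℤ] (simplexAb.{v}.obj n.unop).obj m))
        (map_topSimplex θ).symm

lemma cylinderEnd_evalPath (B : SMod.{v} R) (e : Fin 2) :
    cylinderEnd e (cotensor B interval) ≫ evalPath B = pathEval e B :=
  rfl

lemma simplexAb_map_topSimplex {k : SimplexCategory} {m : SimplexCategoryᵒᵖ}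
    (θ : (SSet.stdSimplex.{v}.obj k).obj m) :
    ((simplexAb.{v}.map (SSet.stdSimplex.objEquiv θ)).app m).hom (topSimplex m) =
      FreeAbelianGroup.of θ :=
  (FreeAbelianGroup.map_of_apply ..).trans (congrArg FreeAbelianGroup.of
    (SSet.stdSimplex.objEquiv.injective (Category.id_comp (SSet.stdSimplex.objEquiv θ))))

/-- A triangle identity. Both sides are additive in the factor `ℤΔ[k]`, so it is enough to compare
them on a simplex `θ`, which is the image of the top simplex under the map that `θ` classifies. -/
lemma curry_evalPath (B : SMod.{v} R) : curry (evalPath B) = 𝟙 _ := by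
  refine NatTrans.ext (funext fun k => ModuleCat.hom_ext (LinearMap.ext fun f => ?_))
  refine abTensor_hom_ext fun m x y => ?_
  let f' : abTensor interval (simplexAb.obj k.unop) ⟶ (forgetAb R).obj B := f
  let F : (simplexAb.{v}.obj k.unop).obj m →+ B.obj m :=
    AddMonoidHom.comp (N := (tensor (cotensor B interval) interval).obj m)
      ((evalPath B).app m).hom.toAddMonoidHom
      (AddMonoidHom.comp (N := (cotensor B interval).obj m)
        ((TensorProduct.mk ℤ ((cotensor B interval).obj m)
        (interval.{v}.obj m)).flip x).toAddMonoidHom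
        ((simplexMap (cotensor B interval) f).app m).hom)
  let G : (simplexAb.{v}.obj k.unop).obj m →+ B.obj m :=
    AddMonoidHom.comp (N := (abTensor interval.{v} (simplexAb.obj k.unop)).obj m)
      (f'.app m).hom
      (TensorProduct.mk ℤ (interval.{v}.obj m) ((simplexAb.{v}.obj k.unop).obj m)
        x).toAddMonoidHom
  have : F = G := by
    refine FreeAbelianGroup.lift_ext _ _ fun θ => ?_
    refine (congrArg (fun z : (cotensor B interval).obj m => ((evalPath B).app m).hom
      (z ⊗ₜ[ℤ] x : (cotensor B interval).obj m ⊗[ℤ] interval.obj m))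
        (simplexMap_of (cotensor B interval) f θ)).trans ?_
    exact congrArg (fun z : (simplexAb.{v}.obj k.unop).obj m => (f'.app m).hom
      (x ⊗ₜ[ℤ] z : interval.{v}.obj m ⊗[ℤ] (simplexAb.{v}.obj k.unop).obj m))
        (simplexAb_map_topSimplex θ)
  exact DFunLike.congr_fun this y

/-- The constant paths. -/
def pathConst (B : SMod.{v} R) : B ⟶ cotensor B interval :=
  curry (cylinderProj B)

lemma pathConst_pathEval (B : SMod.{v} R) (e : Fin 2) : pathConst B ≫ pathEval e B = 𝟙 B := by
  rw [pathConst, curry_pathEval, cylinderEnd_cylinderProj]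

/-- Paths are shrunk to their starting point: at time `t` the path `γ` becomes `s ↦ γ(min(t, s))`.
The homotopy is obtained by currying the path parameter `s`. -/
lemma homotopic_pathEval_pathConst (B : SMod.{v} R) :
    Homotopic (pathEval 0 B ≫ pathConst B) (𝟙 (cotensor B interval)) := by
  refine ⟨curry (cylinderMeet _ ≫ evalPath B), ?_, ?_⟩
  · rw [comp_curry, reassoc_of% cylinderMap_end_zero_cylinderMeet, cylinderEnd_evalPath, pathConst,
      comp_curry, cylinderMap_cylinderProj]
  · rw [comp_curry, reassoc_of% cylinderMap_end_one_cylinderMeet, curry_evalPath]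

end PathObject

/-! ### The characterizations of the three classes -/

section Characterizations

lemma weakEquivalences_iff {A B : SMod.{v} R} (f : A ⟶ B) :
    weakEquivalences R f ↔ IsHomotopyEquivalence f := by
  simp only [IsHomotopyEquivalence, homotopic_iff]
  constructor
  · rintro ⟨e, he⟩
    refine ⟨(normalization R).preimage e.inv, ⟨?_⟩, ⟨?_⟩⟩
    · exact (Homotopy.ofEq (by rw [Functor.map_comp, Functor.map_preimage, he])).trans
        (e.homotopyHomInvId.trans (Homotopy.ofEq ((normalization R).map_id A).symm))
    · exact (Homotopy.ofEq (by rw [Functor.map_comp, Functor.map_preimage, he])).trans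
        (e.homotopyInvHomId.trans (Homotopy.ofEq ((normalization R).map_id B).symm))
  · rintro ⟨g, ⟨h₁⟩, ⟨h₂⟩⟩
    refine ⟨⟨(normalization R).map f, (normalization R).map g, ?_, ?_⟩, rfl⟩
    · exact (Homotopy.ofEq ((normalization R).map_comp f g).symm).trans
        (h₁.trans (Homotopy.ofEq ((normalization R).map_id A)))
    · exact (Homotopy.ofEq ((normalization R).map_comp g f).symm).trans
        (h₂.trans (Homotopy.ofEq ((normalization R).map_id B)))

lemma hasHLP_of_fibrations {E B : SMod.{v} R} {p : E ⟶ B} (hp : fibrations R p) : HasHLP p := by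
  intro A f g h
  have hH : Homotopic (cylinderProj A ≫ cylinderEnd 0 A) (𝟙 _) :=
    ⟨cylinderMeet A, cylinderEnd_zero_cylinderMeet A, cylinderEnd_one_cylinderMeet A⟩
  obtain ⟨H⟩ := (homotopic_iff _ _).1 hH
  obtain ⟨l, hl₀, hl₁⟩ := exists_lift_of_deformationRetract
    (i := (normalization R).map (cylinderEnd 0 A)) (σ := (normalization R).map (cylinderProj A))
    (p := (normalization R).map p)
    (by rw [← Functor.map_comp, cylinderEnd_cylinderProj, CategoryTheory.Functor.map_id])
    ((Homotopy.ofEq (Functor.map_comp _ _ _).symm).trans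
      (H.trans (Homotopy.ofEq (CategoryTheory.Functor.map_id _ _))))
    (fun a b hab => hp b (by have : a + 1 = b := hab; omega))
    ((normalization R).map f) ((normalization R).map g)
    (by rw [← Functor.map_comp, h, Functor.map_comp])
  refine ⟨(normalization R).preimage l, ?_, ?_⟩
  · apply (normalization R).map_injective
    rw [Functor.map_comp, Functor.map_preimage, hl₀]
  · apply (normalization R).map_injective
    rw [Functor.map_comp, Functor.map_preimage, hl₁]

lemma hasHEP_of_cofibrations {A X : SMod.{v} R} {i : A ⟶ X} (hi : cofibrations R i) :
    HasHEP i := by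
  intro B f g h
  obtain ⟨H⟩ := (homotopic_iff _ _).1 (homotopic_pathEval_pathConst B)
  obtain ⟨l, hl₀, hl₁⟩ := exists_lift_of_isSplitMono
    (ev := (normalization R).map (pathEval 0 B)) (s := (normalization R).map (pathConst B))
    (i := (normalization R).map i)
    (by rw [← Functor.map_comp, pathConst_pathEval, CategoryTheory.Functor.map_id])
    ((Homotopy.ofEq (Functor.map_comp _ _ _).symm).trans
      (H.trans (Homotopy.ofEq (CategoryTheory.Functor.map_id _ _))))
    hi ((normalization R).map f) ((normalization R).map g)
    (by rw [← Functor.map_comp, h, Functor.map_comp])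
  refine ⟨(normalization R).preimage l, ?_, ?_⟩
  · apply (normalization R).map_injective
    rw [Functor.map_comp, Functor.map_preimage, hl₀]
  · apply (normalization R).map_injective
    rw [Functor.map_comp, Functor.map_preimage, hl₁]

/-- The simplicial module whose normalization is a disk. -/
def simplicialDisk (M : ModuleCat.{v} R) (m : ℕ) : SMod.{v} R :=
  (normalization R).objPreimage (disk M m)

/-- The normalization of a simplicial disk. -/
def simplicialDiskIso (M : ModuleCat.{v} R) (m : ℕ) :
    (normalization R).obj (simplicialDisk M m) ≅ disk M m :=
  (normalization R).objObjPreimageIso (disk M m)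

lemma homotopic_simplicialDisk (M : ModuleCat.{v} R) (m : ℕ) :
    Homotopic 0 (𝟙 (simplicialDisk M m)) := by
  obtain ⟨h⟩ := nonempty_homotopy_disk M m
  refine (homotopic_iff _ _).2 ⟨?_⟩
  exact (Homotopy.ofEq (by rw [Functor.map_zero]; simp)).trans
    (((h.compLeft (simplicialDiskIso M m).hom).compRight (simplicialDiskIso M m).inv).trans
      (Homotopy.ofEq (by rw [CategoryTheory.Functor.map_id]; simp)))

/-- The endpoints enter through equations because the homotopies to which this applies run between
images under `N`, equal to `0` and `𝟙` only propositionally. -/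
lemma isIso_of_homotopy_simplicialDisk {M : ModuleCat.{v} R} {m : ℕ}
    {f g : (normalization R).obj (simplicialDisk M m) ⟶ (normalization R).obj (simplicialDisk M m)}
    (h : Homotopy f g) (hf : f = 0) (hg : g = 𝟙 _) : IsIso (h.hom m (m + 1)) := by
  subst hf hg
  exact isIso_of_homotopy_disk (simplicialDiskIso M m) h

lemma fibrations_of_hasHLP {E B : SMod.{v} R} {p : E ⟶ B} (hp : HasHLP p) : fibrations R p := by
  intro n hn
  obtain ⟨m, rfl⟩ : ∃ m, n = m + 1 := ⟨n - 1, by omega⟩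
  set M := ((normalization R).obj B).X (m + 1)
  set D := simplicialDisk M m
  obtain ⟨H, h₀, h₁⟩ := homotopic_simplicialDisk M m
  -- The universal test map: the disk on `N(B)` in degree `m + 1` maps to `N(B)` by an isomorphism
  -- in that degree.
  obtain ⟨b, hb⟩ := exists_disk_hom (K := (normalization R).obj B) (m := m) (𝟙 M)
  let b' : D ⟶ B := (normalization R).preimage ((simplicialDiskIso M m).hom ≫ b)
  -- The contraction starts at `0`, so `H ≫ b'` can be lifted starting from the zero map.
  obtain ⟨l, -, hl⟩ := hp D 0 (H ≫ b') (by rw [reassoc_of% h₀, Limits.zero_comp, Limits.zero_comp])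
  let κ := (normalizedCylinderHomotopy D).hom m (m + 1)
  have hb' : IsIso (((normalization R).map b').f (m + 1)) := by
    rw [Functor.map_preimage, HomologicalComplex.comp_f, hb]
    infer_instance
  -- The right side is a component of the contraction of the disk followed by `b'`, both invertible
  -- in this degree; the left side factors through `p`.
  have hκ : (κ ≫ ((normalization R).map l).f (m + 1)) ≫ ((normalization R).map p).f (m + 1) =
      (κ ≫ ((normalization R).map H).f (m + 1)) ≫ ((normalization R).map b').f (m + 1) := by
    rw [Category.assoc, Category.assoc, ← HomologicalComplex.comp_f, ← HomologicalComplex.comp_f,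
      ← Functor.map_comp, ← Functor.map_comp, hl]
  have : IsIso (κ ≫ ((normalization R).map H).f (m + 1)) := by
    rw [← normalizedHomotopy_hom H h₀ h₁]
    exact isIso_of_homotopy_simplicialDisk _ (Functor.map_zero _ _ _)
      (CategoryTheory.Functor.map_id _ _)
  have hκ' : IsIso ((κ ≫ ((normalization R).map l).f (m + 1)) ≫
      ((normalization R).map p).f (m + 1)) := by
    rw [hκ]
    infer_instance
  exact ⟨⟨⟨inv ((κ ≫ ((normalization R).map l).f (m + 1)) ≫
    ((normalization R).map p).f (m + 1)) ≫ κ ≫ ((normalization R).map l).f (m + 1), by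
      rw [Category.assoc]
      exact IsIso.inv_hom_id _⟩⟩⟩

lemma cofibrations_of_hasHEP {A X : SMod.{v} R} {i : A ⟶ X} (hi : HasHEP i) :
    cofibrations R i := by
  intro m
  set M := ((normalization R).obj A).X m
  set D := simplicialDisk M m
  obtain ⟨H, h₀, h₁⟩ := homotopic_simplicialDisk M m
  -- Dually, the test map goes from `N(A)` to a disk and is an isomorphism in the lower degree `m`,
  -- which may be `0`; hence the condition is obtained in every degree.
  obtain ⟨a, ha⟩ := exists_hom_disk (K := (normalization R).obj A) (m := m) (𝟙 M)
  let a' : A ⟶ D := (normalization R).preimage (a ≫ (simplicialDiskIso M m).inv)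
  -- The curried contraction sends each simplex of `D` to a path that starts at `0`, so it can be
  -- extended over the zero map on `X`.
  obtain ⟨l, hl, -⟩ := hi D (a' ≫ curry H) 0
    (by rw [Category.assoc, curry_pathEval, h₀, Limits.comp_zero, Limits.comp_zero])
  let K := normalizedHomotopy (evalPath D) (cylinderEnd_evalPath D 0) (cylinderEnd_evalPath D 1)
  have ha' : IsIso (((normalization R).map a').f m) := by
    rw [Functor.map_preimage, HomologicalComplex.comp_f, ha]
    infer_instance
  have hK : ((normalization R).map i).f m ≫ ((normalization R).map l).f m ≫ K.hom m (m + 1) =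
      ((normalization R).map a').f m ≫ ((normalization R).map (curry H)).f m ≫
        K.hom m (m + 1) := by
    rw [← HomologicalComplex.comp_f_assoc, ← HomologicalComplex.comp_f_assoc,
      ← Functor.map_comp, ← Functor.map_comp, hl]
  -- Precomposing the homotopy from `ev₀` to `ev₁` with `curry H` gives a contraction of the disk.
  have : IsIso (((normalization R).map (curry H)).f m ≫ K.hom m (m + 1)) :=
    isIso_of_homotopy_simplicialDisk (K.compLeft ((normalization R).map (curry H)))
      (by rw [← Functor.map_comp, curry_pathEval, h₀, Functor.map_zero])
      (by rw [← Functor.map_comp, curry_pathEval, h₁, CategoryTheory.Functor.map_id])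
  have hK' : IsIso (((normalization R).map i).f m ≫ ((normalization R).map l).f m ≫
      K.hom m (m + 1)) := by
    rw [hK]
    infer_instance
  exact ⟨⟨⟨(((normalization R).map l).f m ≫ K.hom m (m + 1)) ≫
    inv (((normalization R).map i).f m ≫ ((normalization R).map l).f m ≫ K.hom m (m + 1)), by
      rw [← Category.assoc]
      exact IsIso.hom_inv_id _⟩⟩⟩

end Characterizations

end HurewiczSMod

end

theorem proposition4p2 (R : Type u) [Ring R] :
    (∀ {A B : HurewiczSMod.SMod.{v} R} (f : A ⟶ B),
      HurewiczSMod.weakEquivalences R f ↔ HurewiczSMod.IsHomotopyEquivalence f) ∧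
    (∀ {E B : HurewiczSMod.SMod.{v} R} (p : E ⟶ B),
      HurewiczSMod.fibrations R p ↔ HurewiczSMod.HasHLP p) ∧
    (∀ {A X : HurewiczSMod.SMod.{v} R} (i : A ⟶ X),
      HurewiczSMod.cofibrations R i ↔ HurewiczSMod.HasHEP i) :=
  ⟨HurewiczSMod.weakEquivalences_iff,
    fun _ => ⟨HurewiczSMod.hasHLP_of_fibrations, HurewiczSMod.fibrations_of_hasHLP⟩,
    fun _ => ⟨HurewiczSMod.hasHEP_of_cofibrations, HurewiczSMod.cofibrations_of_hasHEP⟩⟩
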